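/- **Definitions.** A *midpoint set* is a set $X$ with $m\colon X\times X\to X$ satisfying $m(x,x)=x$, $m(x,y)=m(y,x)$ and $m(m(x,y),m(z,w))=m(m(x,z),m(y,w))$. It is *cancellative* if $m(x,y)=m(x,z)$ implies $y=z$, and *iterative* if for every set $Y$ and all maps $h\colon Y\to X$, $t\colon Y\to Y$ there is a unique $k\colon Y\to X$ with $k(y)=m(h(y),k(t(y)))$ for all $y\in Y$. A *midpoint homomorphism* is a function preserving $m$. A *superconvex weight function* is a pair $(I,\lambda)$ of a set $I$ and $\lambda\colon I\to[0,1]$ with $\sum_{i\in I}\lambda_i=1$; it is a *convex weight function* if moreover $\lambda$ has finite support. A *superconvex* (respectively *convex*) *structure* on a set $X$ assigns to each such weight function $(I,\lambda)$ and each family $x\colon I\to X$ an element $\sum_{i\in I}\lambda_i\cdot x_i\in X$ such that $$\sum_{i\in I}\delta_{ik}\cdot x_i=x_k\quad(k\in I),\qquad \sum_{i\in I}\lambda_i\cdot\Bigl(\sum_{j\in J}\mu_{ij}\cdot x_j\Bigr)=\sum_{j\in J}\Bigl(\sum_{i\in I}\lambda_i\mu_{ij}\Bigr)\cdot x_j .$$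 A function is *superaffine* (respectively *affine*) if it preserves all superconvex (respectively convex) combinations. A superconvex set is *cancellative* if $\lambda\cdot x+\mu\cdot z=\lambda\cdot y+\mu\cdot z$ with $\lambda,\mu\in(0,1)$, $\lambda+\mu=1$, implies $x=y$. It is *iterative* if, whenever $x_i=\lambda_i\cdot y_i+\mu_i\cdot x_{i+1}$ for all $i\in\mathbb N$, with $\lambda_i,\mu_i\in(0,1)$, $\lambda_i+\mu_i=1$ and $\lim_{n\to\infty}\prod_{i<n}\mu_i=0$, one has $x_0=\sum_{i\in\mathbb N}\bigl(\lambda_i\prod_{j<i}\mu_j\bigr)\cdot y_i$. **Theorem.** 1. If $X$ is an iterative superconvex set, then $(X,m)$ with $m(x,y)=\frac12\cdot x+\frac12\cdot y$ is an iterative midpoint set; if moreover $X$ is cancellative, then so is $(X,m)$. 2. If $(X,m)$ is an iterative midpoint set, then there is a unique superconvex structure on $X$ with $\frac12\cdot x+\frac12\cdot y=m(x,y)$. This superconvex structure is iterative, and if $(X,m)$ is cancellative then so is the superconvex set $X$. 3. If $(X,m)$ is an iterative midpoint set, there is also a unique convex structure on $X$ with $\frac12\cdot x+\frac12\cdot y=m(x,y)$.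 Let $(X,m)$ and $(X',m')$ be iterative midpoint sets with their unique superconvex and convex structures. For every function $f\colon X\to X'$ the following are equivalent: $f$ is a midpoint homomorphism; $f$ is affine; $f$ is superaffine. 4. The forgetful functor from the category of iterative superconvex sets and superaffine maps to the category of iterative midpoint sets and midpoint homomorphisms, given by $m(x,y)=\frac12\cdot x+\frac12\cdot y$ and identical on underlying functions, is an isomorphism of categories. It restricts to an isomorphism between the full subcategories of cancellative objects. -/

import Mathlib

open CategoryTheory Filter Topology

universe v u

namespace Superconvexity

/-! ### Midpoint sets -/

section Midpoint

variable {X : Type u}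

/-- `m` makes `X` a midpoint set: idempotency, commutativity and transposition. -/
structure IsMidpoint (m : X → X → X) : Prop where
  idem : ∀ x, m x x = x
  comm : ∀ x y, m x y = m y x
  transpose : ∀ x y z w, m (m x y) (m z w) = m (m x z) (m y w)

/-- `(X, m)` is an iterative midpoint set: for every map `c = (h, t) : Y → X × Y` there is a unique
map `k : Y → X` with `k y = m (h y) (k (t y))`. -/
structure IsIterativeMidpoint (m : X → X → X) : Prop extends IsMidpoint m where
  iterative : ∀ (Y : Type u) (c : Y → X × Y), ∃! k : Y → X, ∀ y, k y = m (c y).1 (k (c y).2)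

/-- The cancellation law. -/
def IsCancellativeMidpoint (m : X → X → X) : Prop :=
  ∀ x y z, m x y = m x z → y = z

/-- Midpoint homomorphisms. -/
def IsMidpointHom {X' : Type u} (m : X → X → X) (m' : X' → X' → X') (f : X → X') : Prop :=
  ∀ x y, f (m x y) = m' (f x) (f y)

end Midpoint

/-! ### Superconvex and convex weight functions -/

/-- The two kinds of combinations: countable (superconvex) and finite (convex). -/
inductive Kind
  | superconvex
  | convex

/-- Weight functions over an arbitrary index set `I`: nonnegative real weights, summing to `1`
(hence at most `1` and with countable support), with finite support in the convex case. -/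
structure Weight (K : Kind) (I : Type v) where
  toFun : I → ℝ
  nonneg : ∀ i, 0 ≤ toFun i
  hasSum : HasSum toFun 1
  finite : K = Kind.convex → (Function.support toFun).Finite

instance (K : Kind) (I : Type v) : CoeFun (Weight K I) (fun _ => I → ℝ) := ⟨Weight.toFun⟩

namespace Weight

variable {K : Kind} {I J : Type v}

theorem le_one (w : Weight K I) (i : I) : w i ≤ 1 :=
  le_hasSum w.hasSum i fun j _ => w.nonneg j

open Classical in
/-- The weight function `i ↦ δ_{i k}`. -/
noncomputable def dirac (K : Kind) (k : I) : Weight K I where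
  toFun := fun i => if i = k then 1 else 0
  nonneg := fun i => by split_ifs <;> norm_num
  hasSum := hasSum_ite_eq k 1
  finite := fun _ => (Set.finite_singleton k).subset fun i hi => by
    by_contra h
    exact hi (if_neg h)

theorem summable_mul (w : Weight K I) (μ : I → Weight K J) (j : J) :
    Summable fun i => w i * μ i j :=
  Summable.of_nonneg_of_le (fun i => mul_nonneg (w.nonneg i) ((μ i).nonneg j))
    (fun i => mul_le_of_le_one_right (w.nonneg i) ((μ i).le_one j)) w.hasSum.summable

theorem hasSum_mix (w : Weight K I) (μ : I → Weight K J) :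
    HasSum (fun j => ∑' i, w i * μ i j) 1 := by
  have hrow : ∀ i, HasSum (fun j => w i * μ i j) (w i) := fun i => by
    simpa using (μ i).hasSum.mul_left (w i)
  have hs : Summable fun p : I × J => w p.1 * μ p.1 p.2 := by
    refine (summable_prod_of_nonneg fun p => mul_nonneg (w.nonneg _) ((μ _).nonneg _)).2
      ⟨fun i => (hrow i).summable, ?_⟩
    simpa only [(hrow _).tsum_eq] using w.hasSum.summable
  have h1 : HasSum (fun p : I × J => w p.1 * μ p.1 p.2) 1 := by
    have h := hs.hasSum.prod_fiberwise hrow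
    have h2 := h.unique w.hasSum
    rw [← h2]
    exact hs.hasSum
  have h3 : HasSum (fun p : J × I => w p.2 * μ p.2 p.1) 1 :=
    ((Equiv.prodComm J I).hasSum_iff (f := fun p : I × J => w p.1 * μ p.1 p.2)).2 h1
  exact h3.prod_fiberwise fun j => (summable_mul w μ j).hasSum

/-- The weight function `j ↦ ∑ i, λ i * μ i j`. -/
noncomputable def mix (w : Weight K I) (μ : I → Weight K J) : Weight K J where
  toFun := fun j => ∑' i, w i * μ i j
  nonneg := fun j => tsum_nonneg fun i => mul_nonneg (w.nonneg i) ((μ i).nonneg j)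
  hasSum := hasSum_mix w μ
  finite := fun h => by
    refine ((w.finite h).biUnion fun i _ => (μ i).finite h).subset fun j hj => ?_
    by_contra hc
    refine hj ?_
    have : ∀ i, w i * μ i j = 0 := fun i => by
      by_contra hi
      exact hc (Set.mem_biUnion (left_ne_zero_of_mul hi) (right_ne_zero_of_mul hi))
    simp [this]

/-- The weight function with weights `a`, `b` over a two-element index set. -/
noncomputable def pair (K : Kind) (a b : ℝ) (ha : 0 ≤ a) (hb : 0 ≤ b) (hab : a + b = 1) :
    Weight K (ULift.{v} (Fin 2)) where
  toFun := fun i => ![a, b] i.down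
  nonneg := fun ⟨i⟩ => by fin_cases i <;> simpa
  hasSum := by
    have h : HasSum (fun i : Fin 2 => ![a, b] i) 1 := by
      have h := hasSum_fintype (fun i : Fin 2 => ![a, b] i)
      simpa [hab] using h
    exact (Equiv.ulift.hasSum_iff (f := fun i : Fin 2 => ![a, b] i)).2 h
  finite := fun _ => Set.toFinite _

/-- The weight function `i ↦ a i * ∏ j < i, b j` over `ℕ`, where `a i, b i ≥ 0`,
`a i + b i = 1` and `∏ i < n, b i → 0`. -/
noncomputable def iterated (a b : ℕ → ℝ) (ha : ∀ i, 0 ≤ a i) (hb : ∀ i, 0 ≤ b i)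
    (hab : ∀ i, a i + b i = 1)
    (hlim : Tendsto (fun n => ∏ i ∈ Finset.range n, b i) atTop (𝓝 0)) :
    Weight Kind.superconvex (ULift.{v} ℕ) where
  toFun := fun i => a i.down * ∏ j ∈ Finset.range i.down, b j
  nonneg := fun i => mul_nonneg (ha _) (Finset.prod_nonneg fun j _ => hb j)
  hasSum := by
    have hp : ∀ n, ∑ i ∈ Finset.range n, a i * ∏ j ∈ Finset.range i, b j
        = 1 - ∏ j ∈ Finset.range n, b j := by
      intro n
      induction n with
      | zero => simp
      | succ n ih =>
        rw [Finset.sum_range_succ, ih, Finset.prod_range_succ, eq_sub_of_add_eq (hab n)]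
        ring
    have h : HasSum (fun i : ℕ => a i * ∏ j ∈ Finset.range i, b j) 1 := by
      rw [hasSum_iff_tendsto_nat_of_nonneg
        fun i => mul_nonneg (ha i) (Finset.prod_nonneg fun j _ => hb j)]
      simp only [hp]
      simpa using hlim.const_sub 1
    exact (Equiv.ulift.hasSum_iff
      (f := fun i : ℕ => a i * ∏ j ∈ Finset.range i, b j)).2 h
  finite := fun h => nomatch h

end Weight

/-! ### Superconvex and convex sets -/

/-- A superconvex (respectively convex) structure on `X`: an operation assigning to a weight function
`w` over an index set `I` and a family `x : I → X` an element `∑ i, w i • x i` of `X`, with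
`∑ i, δ_{i k} • x i = x k` and
`∑ i, w i • (∑ j, μ i j • x j) = ∑ j, (∑ i, w i * μ i j) • x j`. -/
structure CombinationStructure (K : Kind) (X : Type u) where
  comb : ∀ {I : Type v}, Weight K I → (I → X) → X
  comb_dirac : ∀ {I : Type v} (k : I) (x : I → X), comb (Weight.dirac K k) x = x k
  comb_comb : ∀ {I J : Type v} (w : Weight K I) (μ : I → Weight K J) (x : J → X),
    comb w (fun i => comb (μ i) x) = comb (w.mix μ) x

/-- Superconvex structures on `X`. -/
abbrev SuperconvexStructure (X : Type u) := CombinationStructure.{v} Kind.superconvex X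

/-- Convex structures on `X`. -/
abbrev ConvexStructure (X : Type u) := CombinationStructure.{v} Kind.convex X

namespace CombinationStructure

variable {K : Kind} {X X' : Type u}

/-- The binary combination `a • x + b • y`. -/
noncomputable def binary (S : CombinationStructure.{v} K X) (a b : ℝ) (ha : 0 ≤ a) (hb : 0 ≤ b)
    (hab : a + b = 1) (x y : X) : X :=
  S.comb (Weight.pair K a b ha hb hab) (fun i => ![x, y] i.down)

/-- The operation `m(x, y) = 1/2 • x + 1/2 • y`. -/
noncomputable def mid (S : CombinationStructure.{v} K X) (x y : X) : X :=
  S.binary (1 / 2) (1 / 2) (by norm_num) (by norm_num) (by norm_num) x y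

/-- Cancellativity, for all proper binary combinations (both weights are in the open unit interval,
being positive with sum `1`). -/
def IsCancellative (S : CombinationStructure.{v} K X) : Prop :=
  ∀ (a b : ℝ) (ha : 0 < a) (hb : 0 < b) (hab : a + b = 1) (x y z : X),
    S.binary a b ha.le hb.le hab x z = S.binary a b ha.le hb.le hab y z → x = y

/-- `f` preserves all combinations: superaffine maps, respectively affine maps. -/
def IsAffine (S : CombinationStructure.{v} K X) (S' : CombinationStructure.{v} K X')
    (f : X → X') : Prop :=
  ∀ {I : Type v} (w : Weight K I) (x : I → X), f (S.comb w x) = S'.comb w (fun i => f (x i))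

/-- Iterativity of a superconvex set: if `x i = a i • y i + b i • x (i + 1)` are proper binary
combinations with `∏ i < n, b i → 0`, then `x 0 = ∑ i, (a i * ∏ j < i, b j) • y i`. -/
def IsIterative (S : SuperconvexStructure.{v} X) : Prop :=
  ∀ (a b : ℕ → ℝ) (ha : ∀ i, 0 < a i) (hb : ∀ i, 0 < b i) (hab : ∀ i, a i + b i = 1)
    (hlim : Tendsto (fun n => ∏ i ∈ Finset.range n, b i) atTop (𝓝 0)) (x y : ℕ → X),
    (∀ i, x i = S.binary (a i) (b i) (ha i).le (hb i).le (hab i) (y i) (x (i + 1))) →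
    x 0 = S.comb (Weight.iterated a b (fun i => (ha i).le) (fun i => (hb i).le) hab hlim)
      (fun i => y i.down)

theorem IsAffine.map_mid {S : CombinationStructure.{v} K X} {S' : CombinationStructure.{v} K X'}
    {f : X → X'} (hf : S.IsAffine S' f) : IsMidpointHom S.mid S'.mid f := by
  intro x y
  refine (hf _ _).trans (congrArg _ (funext fun ⟨i⟩ => ?_))
  fin_cases i <;> rfl

end CombinationStructure

/-! ### The categories -/

/-- Iterative midpoint sets. -/
structure IterMidpointSet where
  carrier : Type u
  m : carrier → carrier → carrier
  isIterative : IsIterativeMidpoint m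

/-- The category of iterative midpoint sets and midpoint homomorphisms. -/
instance : Category IterMidpointSet.{u} where
  Hom A B := {f : A.carrier → B.carrier // IsMidpointHom A.m B.m f}
  id A := ⟨id, fun _ _ => rfl⟩
  comp f g := ⟨g.1 ∘ f.1, fun x y => (congrArg g.1 (f.2 x y)).trans (g.2 _ _)⟩

/-- Iterative superconvex sets. -/
structure IterSuperconvexSet where
  carrier : Type u
  str : SuperconvexStructure.{v} carrier
  isIterative : str.IsIterative

/-- The category of iterative superconvex sets and superaffine maps. -/
instance : Category IterSuperconvexSet.{v, u} where
  Hom A B := {f : A.carrier → B.carrier // A.str.IsAffine B.str f}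
  id A := ⟨id, fun _ _ => rfl⟩
  comp f g := ⟨g.1 ∘ f.1, fun w x => (congrArg g.1 (f.2 w x)).trans (g.2 w _)⟩

/-- The forgetful functor `(X, ∑) ↦ (X, m)`, `m(x, y) = 1/2 • x + 1/2 • y`, identical on underlying
functions; it is defined once the midpoint set of an iterative superconvex set is known to be
iterative. -/
noncomputable def forgetToMidpoint
    (h : ∀ A : IterSuperconvexSet.{v, u}, IsIterativeMidpoint A.str.mid) :
    IterSuperconvexSet.{v, u} ⥤ IterMidpointSet.{u} where
  obj A := ⟨A.carrier, A.str.mid, h A⟩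
  map f := ⟨f.1, CombinationStructure.IsAffine.map_mid f.2⟩

/-- The cancellative iterative midpoint sets. -/
def cancMidpoint : ObjectProperty IterMidpointSet.{u} := fun A => IsCancellativeMidpoint A.m

/-- The cancellative iterative superconvex sets. -/
def cancSuperconvex : ObjectProperty IterSuperconvexSet.{v, u} := fun A => A.str.IsCancellative

/-- A functor is an isomorphism of categories if it has a strict two-sided inverse. -/
def IsCategoryIso {C D : Type*} [Category* C] [Category* D] (F : C ⥤ D) : Prop :=
  ∃ G : D ⥤ C, F ⋙ G = 𝟭 C ∧ G ⋙ F = 𝟭 D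

end Superconvexity

/-!
Every family `x : I → X` in an iterative midpoint set extends uniquely to a midpoint homomorphism
`w ↦ ∑ i, w i • x i` on the weight functions on `I`, whose midpoint is `(w + w') / 2`. The same
proof covers all weight functions and those of finite support. All the claims about existence,
uniqueness and preservation of structures are instances of this universal property.

*Dyadic weights.* Formal iterated midpoints (`MidpointTerm`) have a dyadic weight function and a
value in every midpoint set. Two terms with the same weight function have the same value
(`MidpointTerm.eval_eq_of_weight_eq`): unfolded to perfect binary trees of the same depth, they have
the same multiset of leaves, and transposition allows leaves to be exchanged between the two halves
of a tree (`Average.exchange`, `Average.unique`).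

*Expansions.* Every weight function `w` dominates half the weight of some term `w.below`, strictly
on the support of that term, so that `w` is the midpoint of the weight of `w.below` and of a weight
function `w.rest`. Iterating this expands `w` as `∑ n, 2⁻⁽ⁿ⁺¹⁾ * c n` with the weights `c n` of
terms, and iterativity gives a value to `∑ i, w i • x i`, the infinite midpoint of the values of
these terms. This value does not depend on the expansion: if `p` is the value along any expansion of
`w`, a long initial segment of the expansion dominates half of `w.below`, and the statement on
dyadic weights, applied to terms with one additional variable for the remainder, shows that
`p = m (value of w.below) q` where `q` is the value along some expansion of `w.rest`
(`Represents.exists_mid`). All values of `w` thus solve the same recursion, whose solution is unique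
(`Represents.eq_comb`). Consequently `w ↦ ∑ i, w i • x i` is a midpoint homomorphism, and the only
one that maps the Dirac weights to the `x i` (`IsIterativeMidpoint.eq_comb_of_hom`). Applied to
`w ↦ ∑ i, w i • (∑ j, μ i j • x j)`, to the combinations of another structure, and to
`w ↦ f (∑ i, w i • x i)`, this yields the axioms, the uniqueness of the structure, and the affinity
of midpoint homomorphisms.

*Iterativity.* If `x i = a i • y i + b i • x (i + 1)`, let `w` be the weights `a i * ∏ j < i, b j`.
The combination with weights `w` of `y 0, …, y (n - 1), x n, x n, …` is independent of `n` and
equals `x 0` for `n = 0`. Beyond the finitely many indices occurring in `w.below`, the weights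
`w.rest` are twice the weights `w`, which keeps their proportions; so, for large `n`, these
combinations satisfy the recursion that characterises `∑ i, w i • y i`
(`CombinationStructure.isIterative_of_mid`). Conversely, `k y = ∑ n, 2⁻⁽ⁿ⁺¹⁾ • h (t^[n] y)` is the
unique solution of `k y = m (h y) (k (t y))` in an iterative superconvex set.

*Cancellation.* An equation between proper combinations with `z` may be scaled so that `z` has
weight `1 - 2⁻ⁿ`; it is then an equation between `n`-fold midpoints with `z`.
-/

namespace Superconvexity

/-! ### Iterated midpoints -/

namespace IsIterativeMidpoint

variable {X : Type u} {m : X → X → X}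

/-- The infinite midpoint `m (y 0) (m (y 1) (m (y 2) …))`, that is `∑ n, 2⁻⁽ⁿ⁺¹⁾ • y n`. -/
noncomputable def iter (hm : IsIterativeMidpoint m) : (ℕ → X) → X :=
  (hm.iterative (ℕ → X) fun y => (y 0, fun n => y (n + 1))).choose

theorem iter_eq (hm : IsIterativeMidpoint m) (y : ℕ → X) :
    hm.iter y = m (y 0) (hm.iter fun n => y (n + 1)) :=
  (hm.iterative (ℕ → X) fun y => (y 0, fun n => y (n + 1))).choose_spec.1 y

theorem eq_iter (hm : IsIterativeMidpoint m) {y q : ℕ → X}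
    (h : ∀ n, q n = m (y n) (q (n + 1))) : q 0 = hm.iter y := by
  have key := (hm.iterative (ULift.{u} ℕ) fun i => (y i.down, ⟨i.down + 1⟩)).unique
    (y₁ := fun i => q i.down) (y₂ := fun i => hm.iter fun n => y (n + i.down))
    (fun i => h i.down) fun i => by
      rw [hm.iter_eq]
      simp only [zero_add, add_assoc, add_comm 1]
  simpa using congrFun key ⟨0⟩

theorem iter_const (hm : IsIterativeMidpoint m) (x : X) : hm.iter (fun _ => x) = x :=
  (hm.eq_iter (q := fun _ => x) fun _ => (hm.idem x).symm).symm

theorem iter_mid (hm : IsIterativeMidpoint m) (y z : ℕ → X) :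
    hm.iter (fun n => m (y n) (z n)) = m (hm.iter y) (hm.iter z) := by
  refine (hm.eq_iter (q := fun n => m (hm.iter fun k => y (k + n)) (hm.iter fun k => z (k + n)))
    fun n => ?_).symm
  rw [hm.iter_eq fun k => y (k + n), hm.iter_eq fun k => z (k + n), hm.transpose]
  simp only [zero_add, add_assoc, add_comm 1]

end IsIterativeMidpoint

/-! ### Averages of multisets with `2 ^ n` elements -/

/-- `Average m n s p`: some perfect binary tree of depth `n` with multiset of leaves `s` has
value `p` under `m`. -/
inductive Average {X : Type u} (m : X → X → X) : ℕ → Multiset X → X → Prop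
  | single (x : X) : Average m 0 {x} x
  | add {n : ℕ} {s t : Multiset X} {p q : X} :
      Average m n s p → Average m n t q → Average m (n + 1) (s + t) (m p q)

namespace Average

variable {X : Type u} {m : X → X → X}

theorem card_eq {n : ℕ} {s : Multiset X} {p : X} (h : Average m n s p) :
    Multiset.card s = 2 ^ n := by
  induction h with
  | single x => simp
  | add _ _ h1 h2 => rw [Multiset.card_add, h1, h2, pow_succ]; ring

theorem replicate (hm : IsMidpoint m) (x : X) (n : ℕ) :
    Average m n (Multiset.replicate (2 ^ n) x) x := by
  induction n with
  | zero => exact .single x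
  | succ n ih =>
    have h := ih.add ih
    rwa [hm.idem, ← Multiset.replicate_add, ← two_mul, ← pow_succ'] at h

theorem cons_split (hm : IsMidpoint m) {n : ℕ} {a : X} {s : Multiset X} {p : X}
    (h : Average m (n + 1) (a ::ₘ s) p) :
    ∃ s₁ s₂ p₁ p₂, Average m n (a ::ₘ s₁) p₁ ∧ Average m n s₂ p₂ ∧ s = s₁ + s₂ ∧
      p = m p₁ p₂ := by
  generalize hr : a ::ₘ s = r at h
  cases h with
  | @add _ r₁ r₂ p₁ p₂ h₁ h₂ =>
    have ha : a ∈ r₁ + r₂ := hr ▸ Multiset.mem_cons_self a s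
    rcases Multiset.mem_add.1 ha with ha | ha
    · obtain ⟨u, rfl⟩ := Multiset.exists_cons_of_mem ha
      refine ⟨u, r₂, p₁, p₂, h₁, h₂, ?_, rfl⟩
      simpa using hr
    · obtain ⟨u, rfl⟩ := Multiset.exists_cons_of_mem ha
      refine ⟨u, r₁, p₂, p₁, h₂, h₁, ?_, hm.comm _ _⟩
      simpa [add_comm] using hr

/-- Exchanging a leaf of one tree with a leaf of another one does not change the midpoint of their
values. -/
theorem exchange (hm : IsMidpoint m) {n : ℕ} {a b : X} {s t : Multiset X} {p q : X}
    (hp : Average m n (a ::ₘ s) p) (hq : Average m n (b ::ₘ t) q) :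
    ∃ p' q', Average m n (b ::ₘ s) p' ∧ Average m n (a ::ₘ t) q' ∧ m p q = m p' q' := by
  induction n generalizing s t p q with
  | zero =>
    generalize hr : a ::ₘ s = r at hp
    generalize hr' : b ::ₘ t = r' at hq
    cases hp with
    | single x =>
      cases hq with
      | single y =>
        obtain ⟨rfl, rfl⟩ := (Multiset.singleton_eq_cons_iff _).1 hr.symm
        obtain ⟨rfl, rfl⟩ := (Multiset.singleton_eq_cons_iff _).1 hr'.symm
        exact ⟨_, _, .single _, .single _, hm.comm _ _⟩
  | succ n ih =>
    obtain ⟨s₁, s₂, p₁, p₂, h₁, h₂, rfl, rfl⟩ := cons_split hm hp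
    obtain ⟨t₁, t₂, q₁, q₂, k₁, k₂, rfl, rfl⟩ := cons_split hm hq
    obtain ⟨p', q', hp', hq', e⟩ := ih h₁ k₁
    refine ⟨m p' p₂, m q' q₂, ?_, ?_, ?_⟩
    · simpa using hp'.add h₂
    · simpa using hq'.add k₂
    · rw [hm.transpose, e, hm.transpose]

open Classical in
/-- The value of a perfect binary tree depends only on its multiset of leaves: two trees with the
same leaves are connected by exchanges of leaves between the two halves. -/
theorem unique (hm : IsMidpoint m) {n : ℕ} {s : Multiset X} {p q : X}
    (hp : Average m n s p) (hq : Average m n s q) : p = q := by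
  induction n generalizing s p q with
  | zero =>
    generalize hr : s = r at hq
    cases hp with
    | single x =>
      cases hq with
      | single y => simpa using hr
  | succ n ih =>
    generalize hr : s = r at hq
    cases hp with
    | @add _ s₁ s₂ p₁ p₂ h₁ h₂ =>
    cases hq with
    | @add _ t₁ t₂ q₁ q₂ k₁ k₂ =>
    generalize hk : Multiset.card (s₁ - t₁) = k
    -- Exchange an excess leaf of the left half `s₁` for a leaf that it lacks compared to `t₁`.
    induction k generalizing s₁ s₂ p₁ p₂ with
    | zero =>
      have hle : s₁ ≤ t₁ := tsub_eq_zero_iff_le.1 (Multiset.card_eq_zero.1 hk)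
      obtain rfl := Multiset.eq_of_le_of_card_le hle (by rw [h₁.card_eq, k₁.card_eq])
      obtain rfl := add_left_cancel hr
      rw [ih h₁ k₁, ih h₂ k₂]
    | succ k ihk =>
      obtain ⟨a, ha⟩ := Multiset.card_pos_iff_exists_mem.1 (by omega : 0 < (s₁ - t₁).card)
      have ha' : Multiset.count a t₁ < Multiset.count a s₁ := Multiset.mem_sub.1 ha
      have hb : ∃ b, b ∈ t₁ - s₁ := by
        by_contra! hb
        have hle : t₁ ≤ s₁ := tsub_eq_zero_iff_le.1 (Multiset.eq_zero_of_forall_notMem hb)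
        obtain rfl := Multiset.eq_of_le_of_card_le hle (by rw [h₁.card_eq, k₁.card_eq])
        simp at hk
      obtain ⟨b, hb⟩ := hb
      have hb' : Multiset.count b s₁ < Multiset.count b t₁ := Multiset.mem_sub.1 hb
      have hbs : b ∈ s₂ := by
        have h := congrArg (Multiset.count b) hr
        rw [Multiset.count_add, Multiset.count_add] at h
        exact Multiset.count_pos.1 (by omega)
      obtain ⟨u, rfl⟩ := Multiset.exists_cons_of_mem (Multiset.count_pos.1 (by omega :
        0 < Multiset.count a s₁))
      obtain ⟨w, rfl⟩ := Multiset.exists_cons_of_mem hbs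
      obtain ⟨p', q', hp', hq', e⟩ := exchange hm h₁ h₂
      rw [e]
      refine ihk hp' hq' ?_ ?_
      · rw [← hr]
        simp only [Multiset.cons_add, Multiset.add_cons]
        exact Multiset.cons_swap _ _ _
      · have : (a ::ₘ u) - t₁ = a ::ₘ ((b ::ₘ u) - t₁) := by
          ext i
          simp only [Multiset.count_sub, Multiset.count_cons] at ha' hb' ⊢
          grind
        rw [this, Multiset.card_cons] at hk
        omega

end Average

/-! ### Binary combinations of weight functions -/

namespace Weight

variable {K : Kind} {I : Type v}

theorem ext {w w' : Weight K I} (h : ∀ i, w i = w' i) : w = w' := by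
  cases w; cases w'
  congr
  exact funext h

/-- The weight function `i ↦ a * w i + b * w' i`. -/
noncomputable def convexComb (a b : ℝ) (ha : 0 ≤ a) (hb : 0 ≤ b) (hab : a + b = 1)
    (w w' : Weight K I) : Weight K I where
  toFun i := a * w i + b * w' i
  nonneg i := add_nonneg (mul_nonneg ha (w.nonneg i)) (mul_nonneg hb (w'.nonneg i))
  hasSum := by simpa [hab] using (w.hasSum.mul_left a).add (w'.hasSum.mul_left b)
  finite h := ((w.finite h).union (w'.finite h)).subset fun i hi => by
    by_contra hc
    simp only [Set.mem_union, Function.mem_support, not_or, not_not] at hc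
    exact hi (by simp [hc.1, hc.2])

@[simp]
theorem convexComb_apply (a b : ℝ) (ha : 0 ≤ a) (hb : 0 ≤ b) (hab : a + b = 1)
    (w w' : Weight K I) (i : I) : convexComb a b ha hb hab w w' i = a * w i + b * w' i := rfl

/-- The midpoint of two weight functions. -/
noncomputable def half (w w' : Weight K I) : Weight K I :=
  convexComb (1 / 2) (1 / 2) (by norm_num) (by norm_num) (by norm_num) w w'

@[simp]
theorem half_apply (w w' : Weight K I) (i : I) : half w w' i = (w i + w' i) / 2 := by
  rw [half, convexComb_apply]; ring

open Classical in
theorem dirac_apply (k i : I) : dirac K k i = if i = k then 1 else 0 := rfl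

@[simp]
theorem dirac_self (k : I) : dirac K k k = 1 := by simp [dirac_apply]

theorem dirac_of_ne {k i : I} (h : i ≠ k) : dirac K k i = 0 := by simp [dirac_apply, h]

theorem mix_apply {J : Type v} (w : Weight K I) (μ : I → Weight K J) (j : J) :
    w.mix μ j = ∑' i, w i * μ i j := rfl

theorem mix_dirac {J : Type v} (k : I) (μ : I → Weight K J) : (dirac K k).mix μ = μ k := by
  refine ext fun j => ?_
  rw [mix_apply, tsum_eq_single k fun i hi => by simp [dirac_of_ne hi]]
  simp

theorem mix_convexComb {J : Type v} (a b : ℝ) (ha : 0 ≤ a) (hb : 0 ≤ b) (hab : a + b = 1)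
    (w w' : Weight K I) (μ : I → Weight K J) :
    (convexComb a b ha hb hab w w').mix μ = convexComb a b ha hb hab (w.mix μ) (w'.mix μ) := by
  refine ext fun j => ?_
  simp only [mix_apply, convexComb_apply]
  rw [← tsum_mul_left, ← tsum_mul_left,
    ← ((w.summable_mul μ j).mul_left a).tsum_add ((w'.summable_mul μ j).mul_left b)]
  exact tsum_congr fun i => by ring

theorem pair_mix (a b : ℝ) (ha : 0 ≤ a) (hb : 0 ≤ b) (hab : a + b = 1) (w w' : Weight K I) :
    (pair.{v} K a b ha hb hab).mix (fun i => ![w, w'] i.down) =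
      convexComb a b ha hb hab w w' := by
  refine ext fun j => ?_
  rw [mix_apply, convexComb_apply,
    ← Equiv.ulift.symm.tsum_eq fun i => pair.{v} K a b ha hb hab i * (![w, w'] i.down) j,
    tsum_fintype]
  simp [pair]

theorem pair_eq (a b : ℝ) (ha : 0 ≤ a) (hb : 0 ≤ b) (hab : a + b = 1) :
    pair.{v} K a b ha hb hab = convexComb a b ha hb hab (dirac K ⟨0⟩) (dirac K ⟨1⟩) := by
  refine ext fun ⟨j⟩ => ?_
  fin_cases j <;> simp [pair, dirac_apply]

end Weight

/-! ### Midpoint terms -/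

/-- Formal iterated midpoints of variables in `I`. -/
inductive MidpointTerm (I : Type v) : Type v
  | var (i : I) : MidpointTerm I
  | mid (s t : MidpointTerm I) : MidpointTerm I

namespace MidpointTerm

variable {K : Kind} {I J : Type v} {X : Type u} {m : X → X → X}

/-- The value of a term in a midpoint set. -/
def eval (m : X → X → X) (x : I → X) : MidpointTerm I → X
  | var i => x i
  | mid s t => m (eval m x s) (eval m x t)

/-- Substitution of terms for variables. -/
def bind (f : I → MidpointTerm J) : MidpointTerm I → MidpointTerm J
  | var i => f i
  | mid s t => mid (bind f s) (bind f t)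

/-- The (dyadic, finitely supported) weight function of a term. -/
noncomputable def weight (K : Kind) : MidpointTerm I → Weight K I
  | var i => Weight.dirac K i
  | mid s t => (weight K s).half (weight K t)

theorem finite_support_weight (t : MidpointTerm I) : (Function.support (t.weight K)).Finite := by
  induction t with
  | var i =>
    refine (Set.finite_singleton i).subset fun j hj => ?_
    by_contra h
    exact hj (Weight.dirac_of_ne h)
  | mid s t hs ht =>
    refine (hs.union ht).subset fun i hi => ?_
    by_contra hc
    simp only [Set.mem_union, Function.mem_support, not_or, not_not] at hc
    exact hi (by simp [weight, hc.1, hc.2])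

theorem eval_bind (x : J → X) (f : I → MidpointTerm J) (t : MidpointTerm I) :
    (t.bind f).eval m x = t.eval m fun i => (f i).eval m x := by
  induction t with
  | var i => rfl
  | mid s t hs ht => simp only [bind, eval, hs, ht]

theorem eval_mid (hm : IsMidpoint m) (x y : I → X) (t : MidpointTerm I) :
    t.eval m (fun i => m (x i) (y i)) = m (t.eval m x) (t.eval m y) := by
  induction t with
  | var i => rfl
  | mid s t hs ht => simp only [eval, hs, ht]; rw [hm.transpose]

theorem map_weight_eq_eval (F : Weight K I → X)
    (hF : ∀ w w', F (w.half w') = m (F w) (F w')) (t : MidpointTerm I) :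
    F (t.weight K) = t.eval m fun i => F (Weight.dirac K i) := by
  induction t with
  | var i => rfl
  | mid s t hs ht => simp only [weight, eval, hF, hs, ht]

/-- The height of a term, seen as a binary tree. -/
def depth : MidpointTerm I → ℕ
  | var _ => 0
  | mid s t => max (depth s) (depth t) + 1

/-- The leaves of the perfect binary tree of depth `n` obtained from a term of depth at most `n` by
replacing variables with constant trees; for smaller `n` the value is irrelevant. -/
def leaves : MidpointTerm I → ℕ → Multiset I
  | var i, n => Multiset.replicate (2 ^ n) i
  | mid _ _, 0 => 0
  | mid s t, n + 1 => leaves s n + leaves t n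

theorem card_leaves {t : MidpointTerm I} {n : ℕ} (h : t.depth ≤ n) :
    Multiset.card (t.leaves n) = 2 ^ n := by
  induction t generalizing n with
  | var i => simp [leaves]
  | mid s t hs ht =>
    obtain _ | n := n
    · simp [depth] at h
    · simp only [depth] at h
      rw [leaves, Multiset.card_add, hs (by omega), ht (by omega)]
      ring

open Classical in
theorem weight_eq_count {t : MidpointTerm I} {n : ℕ} (h : t.depth ≤ n) (i : I) :
    t.weight K i = (t.leaves n).count i / 2 ^ n := by
  induction t generalizing n with
  | var k =>
    rw [weight, leaves, Weight.dirac_apply, Multiset.count_replicate]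
    by_cases hik : i = k
    · rw [if_pos hik, if_pos hik.symm]
      simp
    · rw [if_neg hik, if_neg (Ne.symm hik)]
      simp
  | mid s t hs ht =>
    obtain _ | n := n
    · simp [depth] at h
    · simp only [depth] at h
      rw [leaves, Multiset.count_add, weight, Weight.half_apply, hs (by omega : s.depth ≤ n),
        ht (by omega : t.depth ≤ n), pow_succ]
      push_cast
      field_simp

theorem average_leaves (hm : IsMidpoint m) (x : I → X) {t : MidpointTerm I} {n : ℕ}
    (h : t.depth ≤ n) : Average m n ((t.leaves n).map x) (t.eval m x) := by
  induction t generalizing n with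
  | var i => simpa [leaves, eval] using Average.replicate hm (x i) n
  | mid s t hs ht =>
    obtain _ | n := n
    · simp [depth] at h
    · simp only [depth] at h
      rw [leaves, Multiset.map_add]
      exact (hs (by omega)).add (ht (by omega))

/-- In a midpoint set, the value of a term depends only on its weight function. -/
theorem eval_eq_of_weight_eq (hm : IsMidpoint m) (K : Kind) (x : I → X) {s t : MidpointTerm I}
    (h : s.weight K = t.weight K) : s.eval m x = t.eval m x := by
  classical
  have hs := le_max_left s.depth t.depth
  have ht := le_max_right s.depth t.depth
  have hst : s.leaves (max s.depth t.depth) = t.leaves (max s.depth t.depth) := by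
    ext i
    have hi := congrArg (fun w : Weight K I => w i) h
    simp only [weight_eq_count hs, weight_eq_count ht] at hi
    field_simp at hi
    exact_mod_cast hi
  have := average_leaves hm x hs
  rw [hst] at this
  exact this.unique hm (average_leaves hm x ht)

open Classical in
theorem exists_weight_eq_count (K : Kind) {n : ℕ} {s : Multiset I}
    (hs : Multiset.card s = 2 ^ n) :
    ∃ t : MidpointTerm I, ∀ i, t.weight K i = s.count i / 2 ^ n := by
  induction n generalizing s with
  | zero =>
    obtain ⟨i, rfl⟩ := Multiset.card_eq_one.1 (by simpa using hs)
    exact ⟨var i, fun j => by simp [weight, Weight.dirac_apply, Multiset.count_singleton]⟩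
  | succ n ih =>
    obtain ⟨u, hu⟩ := Multiset.card_pos_iff_exists_mem.1
      (by rw [Multiset.card_powersetCard, hs]; exact Nat.choose_pos (by rw [pow_succ]; omega) :
        0 < Multiset.card (Multiset.powersetCard (2 ^ n) s))
    obtain ⟨hus, hcard⟩ := Multiset.mem_powersetCard.1 hu
    obtain ⟨t, rfl⟩ := Multiset.le_iff_exists_add.1 hus
    obtain ⟨a, ha⟩ := ih hcard
    obtain ⟨b, hb⟩ := ih (s := t) (by rw [Multiset.card_add, hcard, pow_succ] at hs; omega)
    refine ⟨mid a b, fun i => ?_⟩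
    rw [weight, Weight.half_apply, ha, hb, Multiset.count_add, pow_succ]
    push_cast
    field_simp

/-- If half the weight of `c` is below the weight of `t`, the other half is the weight of a term. -/
theorem exists_weight_eq_sub (K : Kind) {t c : MidpointTerm I}
    (h : ∀ i, c.weight K i / 2 ≤ t.weight K i) :
    ∃ r : MidpointTerm I, ∀ i, r.weight K i = 2 * t.weight K i - c.weight K i := by
  classical
  set n := max t.depth c.depth with hn
  have ht : t.depth ≤ n + 1 := by omega
  have hc : c.depth ≤ n := by omega
  have hle : c.leaves n ≤ t.leaves (n + 1) := Multiset.le_iff_count.2 fun i => by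
    have hi := h i
    rw [weight_eq_count ht, weight_eq_count hc, pow_succ] at hi
    field_simp at hi
    exact_mod_cast hi
  obtain ⟨s, hs⟩ := Multiset.le_iff_exists_add.1 hle
  have hcard := card_leaves ht
  rw [hs, Multiset.card_add, card_leaves hc, pow_succ] at hcard
  obtain ⟨r, hr⟩ := exists_weight_eq_count K (s := s) (n := n) (by omega)
  refine ⟨r, fun i => ?_⟩
  rw [hr, weight_eq_count ht, weight_eq_count hc, hs, Multiset.count_add, pow_succ]
  push_cast
  field_simp
  ring

/-- The term `mid (c 0) (mid (c 1) (… (mid (c (n - 1)) ∗)))`, with an additional variable `∗`. -/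
def spine (c : ℕ → MidpointTerm I) : ℕ → MidpointTerm (Option I)
  | 0 => var none
  | n + 1 => mid ((c 0).bind fun i => var (some i)) (spine (fun k => c (k + 1)) n)

theorem weight_bind_some (t : MidpointTerm I) (i : I) :
    (t.bind fun i => var (some i)).weight K (some i) = t.weight K i := by
  induction t with
  | var k => by_cases h : i = k <;> simp [bind, weight, Weight.dirac_apply, h]
  | mid s t hs ht => simp [bind, weight, hs, ht]

theorem weight_bind_none (t : MidpointTerm I) :
    (t.bind fun i => var (some i)).weight K none = 0 := by
  induction t with
  | var k => simp [bind, weight, Weight.dirac_apply]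
  | mid s t hs ht => simp [bind, weight, hs, ht]

theorem weight_spine_none (c : ℕ → MidpointTerm I) (n : ℕ) :
    (spine c n).weight K none = (1 / 2) ^ n := by
  induction n generalizing c with
  | zero => simp [spine, weight]
  | succ n ih =>
    simp only [spine, weight, Weight.half_apply, weight_bind_none, ih, pow_succ]
    ring

theorem weight_spine_some (c : ℕ → MidpointTerm I) (n : ℕ) (i : I) :
    (spine c n).weight K (some i) =
      ∑ k ∈ Finset.range n, (1 / 2) ^ (k + 1) * (c k).weight K i := by
  induction n generalizing c with
  | zero => simp [spine, weight, Weight.dirac_apply]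
  | succ n ih =>
    rw [Finset.sum_range_succ']
    simp only [spine, weight, Weight.half_apply, weight_bind_some, ih, add_div, Finset.sum_div]
    rw [add_comm]
    congr 1
    · exact Finset.sum_congr rfl fun k _ => by ring
    · ring

/-- The assignment extending `x` by the value `p` of the additional variable. -/
def extendVar (x : I → X) (p : X) : Option I → X
  | none => p
  | some i => x i

/-- Evaluating the first `n` stages of an infinite midpoint, with its remainder `q n` for the
additional variable, gives its value. -/
theorem eval_spine (x : I → X) (c : ℕ → MidpointTerm I) {q : ℕ → X}
    (hq : ∀ n, q n = m ((c n).eval m x) (q (n + 1))) (n : ℕ) :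
    (spine c n).eval m (extendVar x (q n)) = q 0 := by
  induction n generalizing c q with
  | zero => rfl
  | succ n ih =>
    rw [spine, eval, eval_bind, hq 0]
    exact congrArg _ (ih (fun k => c (k + 1)) (q := fun k => q (k + 1)) fun k => hq (k + 1))

theorem eval_extendVar_mid (hm : IsMidpoint m) (x : I → X) (p q : X)
    (t : MidpointTerm (Option I)) :
    t.eval m (extendVar x (m p q)) = m (t.eval m (extendVar x p)) (t.eval m (extendVar x q)) := by
  rw [← eval_mid hm]
  congr
  funext i
  cases i <;> simp [extendVar, hm.idem]

/-- Substitution of `c` for the additional variable. -/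
def substNone (c : MidpointTerm I) (t : MidpointTerm (Option I)) : MidpointTerm I :=
  t.bind (extendVar var c)

theorem eval_substNone (x : I → X) (c : MidpointTerm I) (t : MidpointTerm (Option I)) :
    (substNone c t).eval m x = t.eval m (extendVar x (c.eval m x)) := by
  rw [substNone, eval_bind]
  congr
  funext i
  cases i <;> rfl

theorem weight_substNone (c : MidpointTerm I) (t : MidpointTerm (Option I)) (i : I) :
    (substNone c t).weight K i = t.weight K (some i) + t.weight K none * c.weight K i := by
  induction t with
  | var k =>
    obtain _ | k := k
    · simp [substNone, bind, extendVar, weight, Weight.dirac_apply]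
    · by_cases h : i = k <;> simp [substNone, bind, extendVar, weight, Weight.dirac_apply, h]
  | mid s t hs ht =>
    simp only [substNone] at hs ht
    simp only [substNone, bind, weight, Weight.half_apply, hs, ht]
    ring

end MidpointTerm

/-! ### Dyadic expansions of weight functions -/

namespace Weight

variable {K : Kind} {I : Type v}

/-- Every weight function `w` strictly dominates half the weight function of some term, on the
support of that term: round the numbers `2 ^ (n + 1) * w i` down for a large `n`. -/
theorem exists_term_below (w : Weight K I) :
    ∃ c : MidpointTerm I, ∀ i, c.weight K i ≠ 0 → c.weight K i / 2 < w i := by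
  classical
  obtain ⟨F, hF⟩ : ∃ F : Finset I, 1 / 2 < ∑ i ∈ F, w i := by
    by_contra! h
    have := hasSum_le_of_sum_le w.hasSum h
    norm_num at this
  set S := ∑ i ∈ F, w i
  obtain ⟨n, hn⟩ := pow_unbounded_of_one_lt (F.card / (2 * S - 1)) (one_lt_two (α := ℝ))
  rw [div_lt_iff₀ (by linarith)] at hn
  let a : I → ℕ := fun i => ⌈2 ^ (n + 1) * w i⌉₊ - 1
  have ha : ∀ i, 2 ^ (n + 1) * w i - 1 ≤ a i := fun i => by
    have h1 : 2 ^ (n + 1) * w i ≤ ⌈2 ^ (n + 1) * w i⌉₊ := Nat.le_ceil _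
    have h2 : (⌈2 ^ (n + 1) * w i⌉₊ : ℝ) ≤ a i + 1 := by
      have h3 : ⌈2 ^ (n + 1) * w i⌉₊ ≤ a i + 1 := by simp only [a]; omega
      exact_mod_cast h3
    linarith
  have ha' : ∀ i, a i ≠ 0 → (a i : ℝ) < 2 ^ (n + 1) * w i := fun i hi =>
    Nat.lt_ceil.1 (by simp only [a] at hi ⊢; omega)
  let s : Multiset I := ∑ i ∈ F, Multiset.replicate (a i) i
  have hcount : ∀ i, s.count i ≤ a i := fun i => by
    rw [Multiset.count_sum']
    simp only [Multiset.count_replicate, Finset.sum_ite_eq']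
    split_ifs <;> omega
  have hcard : 2 ^ n ≤ Multiset.card s := by
    have h1 : ∑ i ∈ F, (2 ^ (n + 1) * w i - 1) ≤ ∑ i ∈ F, (a i : ℝ) :=
      Finset.sum_le_sum fun i _ => ha i
    rw [Finset.sum_sub_distrib, ← Finset.mul_sum, Finset.sum_const, nsmul_eq_mul, mul_one] at h1
    have h2 : (2 : ℝ) ^ n ≤ ∑ i ∈ F, (a i : ℝ) := by
      rw [pow_succ] at h1
      change _ * S - _ ≤ _ at h1
      linarith
    rw [Multiset.card_sum]
    simp only [Multiset.card_replicate]
    exact_mod_cast h2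
  obtain ⟨u, hu⟩ := Multiset.card_pos_iff_exists_mem.1
    (by rw [Multiset.card_powersetCard]; exact Nat.choose_pos hcard :
      0 < Multiset.card (Multiset.powersetCard (2 ^ n) s))
  obtain ⟨hus, hu⟩ := Multiset.mem_powersetCard.1 hu
  obtain ⟨c, hc⟩ := MidpointTerm.exists_weight_eq_count K hu
  refine ⟨c, fun i hi => ?_⟩
  rw [hc] at hi ⊢
  have h0 : u.count i ≠ 0 := fun h => hi (by simp [h])
  have hle : u.count i ≤ a i := (Multiset.le_iff_count.1 hus i).trans (hcount i)
  have h1 := ha' i (by omega)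
  have h2 : (u.count i : ℝ) ≤ a i := by exact_mod_cast hle
  rw [div_div, div_lt_iff₀ (by positivity), ← pow_succ, mul_comm]
  exact h2.trans_lt h1

/-- A term whose weight function is strictly below `2 * w` on its support. -/
noncomputable def below (w : Weight K I) : MidpointTerm I := w.exists_term_below.choose

theorem below_lt (w : Weight K I) {i : I} (h : w.below.weight K i ≠ 0) :
    w.below.weight K i / 2 < w i := w.exists_term_below.choose_spec i h

theorem below_le (w : Weight K I) (i : I) : w.below.weight K i / 2 ≤ w i := by
  by_cases h : w.below.weight K i = 0
  · simpa [h] using w.nonneg i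
  · exact (w.below_lt h).le

/-- The other half of `w`, so that `w` is the midpoint of the weight function of `w.below` and of
`w.rest`. -/
noncomputable def rest (w : Weight K I) : Weight K I where
  toFun i := 2 * w i - w.below.weight K i
  nonneg i := by linarith [w.below_le i]
  hasSum := by
    have h := (w.hasSum.mul_left 2).sub (w.below.weight K).hasSum
    norm_num at h
    exact h
  finite h := (w.finite h).subset fun i hi hc => hi (by
    have h0 : w i = 0 := hc
    have h1 := w.below_le i
    have h2 := (w.below.weight K).nonneg i
    simp only [h0] at h1 ⊢
    linarith)

theorem rest_apply (w : Weight K I) (i : I) : w.rest i = 2 * w i - w.below.weight K i := rfl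

theorem half_below_rest (w : Weight K I) : (w.below.weight K).half w.rest = w :=
  ext fun i => by rw [half_apply, rest_apply]; ring

/-- The terms of the dyadic expansion `w = ∑ n, 2⁻⁽ⁿ⁺¹⁾ * w.digit n`. -/
noncomputable def digit (w : Weight K I) (n : ℕ) : MidpointTerm I := (rest^[n] w).below

theorem hasSum_digit (w : Weight K I) (i : I) :
    HasSum (fun n => (1 / 2) ^ (n + 1) * (w.digit n).weight K i) (w i) := by
  have hp : ∀ n, ∑ k ∈ Finset.range n, (1 / 2) ^ (k + 1) * (w.digit k).weight K i =
      w i - (1 / 2) ^ n * (rest^[n] w) i := by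
    intro n
    induction n with
    | zero => simp
    | succ n ih =>
      rw [Finset.sum_range_succ, ih, Function.iterate_succ_apply', rest_apply, digit, pow_succ]
      ring
  rw [hasSum_iff_tendsto_nat_of_nonneg
    fun n => mul_nonneg (by positivity) ((w.digit n |>.weight K).nonneg i)]
  simp only [hp]
  have h0 : Tendsto (fun n : ℕ => (1 / 2 : ℝ) ^ n) atTop (𝓝 0) :=
    tendsto_pow_atTop_nhds_zero_of_lt_one (by norm_num) (by norm_num)
  have h1 : Tendsto (fun n : ℕ => (1 / 2 : ℝ) ^ n * (rest^[n] w) i) atTop (𝓝 0) :=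
    squeeze_zero (fun n => mul_nonneg (by positivity) (Weight.nonneg _ i))
      (fun n => mul_le_of_le_one_right (by positivity) (Weight.le_one _ i)) h0
  simpa using h1.const_sub (w i)

end Weight

/-! ### Combinations in an iterative midpoint set -/

theorem hasSum_half_pow : HasSum (fun n : ℕ => (1 / 2 : ℝ) ^ (n + 1)) 1 := by
  have h := hasSum_geometric_two.div_const 2
  norm_num at h
  simpa [pow_succ, div_eq_mul_inv] using h

namespace IsIterativeMidpoint

variable {K : Kind} {I : Type v} {X : Type u} {m : X → X → X}

/-- `p` is a value of the combination `∑ i, w i • x i`: it is the infinite midpoint of the values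
of the terms of some dyadic expansion of `w`. -/
def Represents (hm : IsIterativeMidpoint m) (x : I → X) (w : Weight K I) (p : X) : Prop :=
  ∃ c : ℕ → MidpointTerm I,
    (∀ i, HasSum (fun n => (1 / 2) ^ (n + 1) * (c n).weight K i) (w i)) ∧
      hm.iter (fun n => (c n).eval m x) = p

theorem Represents.mid {hm : IsIterativeMidpoint m} {x : I → X} {w w' : Weight K I} {p p' : X}
    (h : hm.Represents x w p) (h' : hm.Represents x w' p') :
    hm.Represents x (w.half w') (m p p') := by
  obtain ⟨c, hc, rfl⟩ := h
  obtain ⟨c', hc', rfl⟩ := h'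
  refine ⟨fun n => .mid (c n) (c' n), fun i => ?_, hm.iter_mid _ _⟩
  rw [Weight.half_apply]
  refine (((hc i).add (hc' i)).div_const 2).congr_fun fun n => ?_
  simp only [MidpointTerm.weight, Weight.half_apply]
  ring

theorem represents_dirac (hm : IsIterativeMidpoint m) (x : I → X) (k : I) :
    hm.Represents x (Weight.dirac K k) (x k) := by
  refine ⟨fun _ => .var k, fun i => ?_, hm.iter_const _⟩
  simpa [MidpointTerm.weight] using hasSum_half_pow.mul_right (Weight.dirac K k i)

/-- Every value of `∑ i, w i • x i` is the midpoint of the value of `w.below` and of a value for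
`w.rest`. The strictness in the choice of `w.below` makes some finite initial segment of the given
expansion of `w` dominate half of `w.below`. -/
theorem Represents.exists_mid {hm : IsIterativeMidpoint m} {x : I → X} {w : Weight K I} {p : X}
    (h : hm.Represents x w p) :
    ∃ q, hm.Represents x w.rest q ∧ p = m (w.below.eval m x) q := by
  obtain ⟨c, hc, rfl⟩ := h
  -- An initial segment of the expansion that dominates half the weight of `w.below`.
  obtain ⟨N, hN⟩ : ∃ N, ∀ i, w.below.weight K i / 2 ≤
      ∑ k ∈ Finset.range N, (1 / 2) ^ (k + 1) * (c k).weight K i := by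
    have hev : ∀ᶠ N in atTop, ∀ i ∈ Function.support (w.below.weight K), w.below.weight K i / 2 ≤
        ∑ k ∈ Finset.range N, (1 / 2) ^ (k + 1) * (c k).weight K i := by
      rw [eventually_all_finite w.below.finite_support_weight]
      intro i hi
      exact ((hc i).tendsto_sum_nat.eventually (lt_mem_nhds (w.below_lt hi))).mono
        fun _ h => h.le
    obtain ⟨N, hN⟩ := hev.exists
    refine ⟨N, fun i => ?_⟩
    by_cases hi : w.below.weight K i = 0
    · rw [hi, zero_div]
      exact Finset.sum_nonneg fun k _ => mul_nonneg (by positivity) (Weight.nonneg _ i)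
    · exact hN i hi
  set τ := MidpointTerm.spine c N with hτ
  let b : MidpointTerm (Option I) := w.below.bind fun i => .var (some i)
  obtain ⟨r, hr⟩ := MidpointTerm.exists_weight_eq_sub K (t := τ) (c := b) (by
    rintro (_ | i)
    · rw [MidpointTerm.weight_bind_none, zero_div]
      exact Weight.nonneg _ _
    · rw [MidpointTerm.weight_bind_some, hτ, MidpointTerm.weight_spine_some]
      exact hN i)
  have hbr : τ.weight K = (MidpointTerm.mid b r).weight K := Weight.ext fun i => by
    rw [MidpointTerm.weight, Weight.half_apply, hr]
    ring
  -- The remainders of the infinite midpoint; `r` is evaluated with `q N` for the variable `none`.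
  let q : ℕ → X := fun n => hm.iter fun k => (c (k + n)).eval m x
  have hq : ∀ n, q n = m ((c n).eval m x) (q (n + 1)) := fun n => by
    simp only [q]
    rw [hm.iter_eq]
    simp only [zero_add, add_assoc, add_comm 1]
  refine ⟨r.eval m (MidpointTerm.extendVar x (q N)),
    ⟨fun n => (c (n + N)).substNone r, fun i => ?_, ?_⟩, ?_⟩
  · have h1 : r.weight K none = 2 * (1 / 2) ^ N := by
      rw [hr, MidpointTerm.weight_bind_none, hτ, MidpointTerm.weight_spine_none, sub_zero]
    have h2 : r.weight K (some i) = 2 * ∑ k ∈ Finset.range N,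
        (1 / 2) ^ (k + 1) * (c k).weight K i - w.below.weight K i := by
      rw [hr, MidpointTerm.weight_bind_some, hτ, MidpointTerm.weight_spine_some]
    have h3 := (hasSum_nat_add_iff' N).2 (hc i)
    have h4 := hasSum_half_pow.mul_right (r.weight K (some i))
    have h5 := h4.add (h3.mul_left 2)
    have h6 : w.rest i = 1 * r.weight K (some i) + 2 * (w i - ∑ k ∈ Finset.range N,
        (1 / 2) ^ (k + 1) * (c k).weight K i) := by
      rw [h2, Weight.rest_apply]
      ring
    rw [h6]
    refine h5.congr_fun fun n => ?_
    simp only [MidpointTerm.weight_substNone, h1, pow_add]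
    ring
  · simp only [MidpointTerm.eval_substNone]
    refine (hm.eq_iter (q := fun n => r.eval m (MidpointTerm.extendVar x (q (n + N)))) fun n => ?_
      ).symm.trans (by rw [zero_add])
    rw [hq, MidpointTerm.eval_extendVar_mid hm.toIsMidpoint, add_right_comm]
  · have h1 := MidpointTerm.eval_eq_of_weight_eq hm.toIsMidpoint K
      (MidpointTerm.extendVar x (q N)) hbr
    rw [hτ, MidpointTerm.eval_spine x c hq, MidpointTerm.eval, MidpointTerm.eval_bind] at h1
    exact h1

/-- The combination `∑ i, w i • x i` in an iterative midpoint set. -/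
noncomputable def comb (hm : IsIterativeMidpoint m) (w : Weight K I) (x : I → X) : X :=
  hm.iter fun n => (w.digit n).eval m x

theorem represents_comb (hm : IsIterativeMidpoint m) (w : Weight K I) (x : I → X) :
    hm.Represents x w (hm.comb w x) := ⟨w.digit, w.hasSum_digit, rfl⟩

/-- A function on weight functions that satisfies the recursion `w ↦ w.rest` on an invariant set
is the combination. -/
theorem eq_comb_of_rec (hm : IsIterativeMidpoint m) (x : I → X) (Q : Weight K I → Prop)
    (hQ : ∀ w, Q w → Q w.rest) (F : Weight K I → X)
    (hF : ∀ w, Q w → F w = m (w.below.eval m x) (F w.rest)) {w : Weight K I} (hw : Q w) :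
    F w = hm.comb w x := by
  have hQn : ∀ n, Q (Weight.rest^[n] w) := fun n => by
    induction n with
    | zero => exact hw
    | succ n ih => rw [Function.iterate_succ_apply']; exact hQ _ ih
  refine hm.eq_iter (q := fun n => F (Weight.rest^[n] w)) fun n => ?_
  rw [hF _ (hQn n), ← Function.iterate_succ_apply' Weight.rest]
  rfl

theorem Represents.eq_comb {hm : IsIterativeMidpoint m} {x : I → X} {w : Weight K I} {p : X}
    (h : hm.Represents x w p) : p = hm.comb w x := by
  -- The pairs of a weight function and a value of it, with the step provided by `exists_mid`.
  let S := {a : Weight K I × X // hm.Represents x a.1 a.2}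
  let step : S → S := fun a => ⟨(a.1.1.rest, a.2.exists_mid.choose), a.2.exists_mid.choose_spec.1⟩
  have hstep : ∀ (n : ℕ) (a : S), (step^[n] a).1.1 = Weight.rest^[n] a.1.1 := fun n => by
    induction n with
    | zero => exact fun _ => rfl
    | succ n ih => exact fun a => ih (step a)
  let a : S := ⟨(w, p), h⟩
  refine hm.eq_iter (q := fun n => (step^[n] a).1.2) fun n => ?_
  rw [Function.iterate_succ_apply', Weight.digit]
  change _ = m ((Weight.rest^[n] a.1.1).below.eval m x) _
  rw [← hstep]
  exact (step^[n] a).2.exists_mid.choose_spec.2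

theorem comb_half (hm : IsIterativeMidpoint m) (w w' : Weight K I) (x : I → X) :
    hm.comb (w.half w') x = m (hm.comb w x) (hm.comb w' x) :=
  ((hm.represents_comb w x).mid (hm.represents_comb w' x)).eq_comb.symm

theorem comb_dirac (hm : IsIterativeMidpoint m) (k : I) (x : I → X) :
    hm.comb (Weight.dirac K k) x = x k := (hm.represents_dirac x k).eq_comb.symm

/-- A midpoint homomorphism on weight functions is determined by its values at the Dirac weight
functions: it preserves the values of terms and the recursion `w ↦ w.rest`. -/
theorem eq_comb_of_hom (hm : IsIterativeMidpoint m) (F : Weight K I → X)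
    (hF : ∀ w w', F (w.half w') = m (F w) (F w')) (w : Weight K I) :
    F w = hm.comb w fun i => F (Weight.dirac K i) := by
  refine hm.eq_comb_of_rec _ (fun _ => True) (fun _ _ => trivial) F (fun w _ => ?_) trivial
  rw [← MidpointTerm.map_weight_eq_eval F hF, ← hF, Weight.half_below_rest]

/-- The superconvex, respectively convex, structure of an iterative midpoint set. -/
noncomputable def combinationStructure (K : Kind) (hm : IsIterativeMidpoint m) :
    CombinationStructure.{v} K X where
  comb := hm.comb
  comb_dirac := hm.comb_dirac
  comb_comb w μ x := by
    have h := hm.eq_comb_of_hom (fun w : Weight K _ => hm.comb (w.mix μ) x) (fun w w' => by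
      rw [← hm.comb_half, Weight.half, Weight.mix_convexComb]; rfl) w
    simp only [Weight.mix_dirac] at h
    exact h.symm

end IsIterativeMidpoint

namespace CombinationStructure

variable {K : Kind} {X X' : Type u}

theorem comb_convexComb (S : CombinationStructure.{v} K X) {I : Type v} (a b : ℝ) (ha : 0 ≤ a)
    (hb : 0 ≤ b) (hab : a + b = 1) (w w' : Weight K I) (x : I → X) :
    S.comb (Weight.convexComb a b ha hb hab w w') x =
      S.binary a b ha hb hab (S.comb w x) (S.comb w' x) := by
  rw [← Weight.pair_mix, ← S.comb_comb, binary]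
  congr 1
  funext ⟨i⟩
  fin_cases i <;> rfl

theorem comb_half (S : CombinationStructure.{v} K X) {I : Type v} (w w' : Weight K I)
    (x : I → X) : S.comb (w.half w') x = S.mid (S.comb w x) (S.comb w' x) :=
  S.comb_convexComb _ _ _ _ _ w w' x

theorem comb_eq (S : CombinationStructure.{v} K X) {m : X → X → X} (hm : IsIterativeMidpoint m)
    (hS : S.mid = m) {I : Type v} (w : Weight K I) (x : I → X) : S.comb w x = hm.comb w x := by
  have h := hm.eq_comb_of_hom (fun w => S.comb w x) (fun w w' => by rw [S.comb_half, hS]) w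
  simpa only [S.comb_dirac] using h

theorem ext {S S' : CombinationStructure.{v} K X}
    (h : ∀ {I : Type v} (w : Weight K I) (x : I → X), S.comb w x = S'.comb w x) : S = S' := by
  cases S; cases S'
  congr
  funext I w x
  exact h w x

end CombinationStructure

namespace IsIterativeMidpoint

variable {X : Type u} {m : X → X → X}

theorem mid_combinationStructure (K : Kind) (hm : IsIterativeMidpoint m) :
    (hm.combinationStructure K : CombinationStructure.{v} K X).mid = m := by
  funext x y
  change hm.comb (Weight.pair K _ _ _ _ _) _ = _
  rw [Weight.pair_eq]
  refine (hm.comb_half _ _ _).trans ?_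
  rw [hm.comb_dirac, hm.comb_dirac]
  rfl

/-- Any other structure with the same midpoints has midpoint homomorphisms as combinations, hence
agrees with `combinationStructure`. -/
theorem existsUnique_combinationStructure (K : Kind) (hm : IsIterativeMidpoint m) :
    ∃! S : CombinationStructure.{v} K X, S.mid = m :=
  ⟨hm.combinationStructure K, hm.mid_combinationStructure K, fun S hS =>
    CombinationStructure.ext fun w x => S.comb_eq hm hS w x⟩

end IsIterativeMidpoint

namespace CombinationStructure

variable {K : Kind} {X X' : Type u}

/-- For a midpoint homomorphism `f`, the function `w ↦ f (∑ i, w i • x i)` is one as well, hence it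
is the combination of the `f (x i)`. -/
theorem isAffine_iff_isMidpointHom {S : CombinationStructure.{v} K X}
    {S' : CombinationStructure.{v} K X'} {m : X → X → X} {m' : X' → X' → X'}
    (hm' : IsIterativeMidpoint m') (hS : S.mid = m) (hS' : S'.mid = m') {f : X → X'} :
    S.IsAffine S' f ↔ IsMidpointHom m m' f := by
  subst hS hS'
  refine ⟨fun h => h.map_mid, fun h I w x => ?_⟩
  have key := hm'.eq_comb_of_hom (fun w => f (S.comb w x))
    (fun w w' => by rw [S.comb_half, h]) w
  simp only [S.comb_dirac] at key
  rw [key, S'.comb_eq hm' rfl]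

end CombinationStructure

/-! ### From iterative superconvex sets to iterative midpoint sets -/

namespace Weight

theorem tendsto_prod_half :
    Tendsto (fun n => ∏ _i ∈ Finset.range n, (1 / 2 : ℝ)) atTop (𝓝 0) := by
  simp only [Finset.prod_const, Finset.card_range]
  exact tendsto_pow_atTop_nhds_zero_of_lt_one (by norm_num) (by norm_num)

/-- The weights `2⁻⁽ⁿ⁺¹⁾` over `ℕ`. -/
noncomputable def geometric : Weight Kind.superconvex (ULift.{v} ℕ) :=
  iterated (fun _ => 1 / 2) (fun _ => 1 / 2) (fun _ => by norm_num) (fun _ => by norm_num)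
    (fun _ => by norm_num) tendsto_prod_half

theorem geometric_apply (i : ULift.{v} ℕ) : geometric i = (1 / 2) ^ (i.down + 1) := by
  simp [geometric, iterated, pow_succ, mul_comm]

theorem geometric_eq_half : geometric.{v} = (dirac _ ⟨0⟩).half
    (geometric.mix fun i => dirac _ ⟨i.down + 1⟩) := by
  refine ext fun ⟨i⟩ => ?_
  rw [half_apply, mix_apply]
  obtain _ | i := i
  · simp [dirac_apply, geometric_apply]
  · rw [tsum_eq_single ⟨i⟩ fun j hj => by
      rw [dirac_of_ne, mul_zero]
      intro h
      exact hj (ULift.ext _ _ (by simpa using (congrArg ULift.down h).symm))]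
    simp [dirac_apply, geometric_apply, pow_succ]
    ring

end Weight

namespace CombinationStructure

variable {K : Kind} {X : Type u}

theorem mid_apply (S : CombinationStructure.{v} K X) {I : Type v} (x : I → X) (i j : I) :
    S.mid (x i) (x j) = S.comb ((Weight.dirac K i).half (Weight.dirac K j)) x := by
  rw [S.comb_half, S.comb_dirac, S.comb_dirac]

theorem isMidpoint_mid (S : CombinationStructure.{v} K X) : IsMidpoint S.mid where
  idem x := by
    rw [S.mid_apply (fun _ : PUnit.{v + 1} => x) ⟨⟩ ⟨⟩]
    refine Eq.trans ?_ (S.comb_dirac (PUnit.unit : PUnit.{v + 1}) fun _ => x)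
    congr 1
    exact Weight.ext fun i => by simp
  comm x y := by
    have h := S.mid_apply (fun i : ULift.{v} (Fin 2) => ![x, y] i.down)
    refine (h ⟨0⟩ ⟨1⟩).trans (Eq.trans ?_ (h ⟨1⟩ ⟨0⟩).symm)
    congr 1
    exact Weight.ext fun i => by simp [add_comm]
  transpose x y z w := by
    have h := S.mid_apply (fun i : ULift.{v} (Fin 4) => ![x, y, z, w] i.down)
    have e : ∀ i j k l, S.mid (S.mid (![x, y, z, w] i) (![x, y, z, w] j))
        (S.mid (![x, y, z, w] k) (![x, y, z, w] l)) = S.mid (S.mid (![x, y, z, w] i)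
        (![x, y, z, w] k)) (S.mid (![x, y, z, w] j) (![x, y, z, w] l)) := fun i j k l => by
      rw [h ⟨i⟩ ⟨j⟩, h ⟨k⟩ ⟨l⟩, h ⟨i⟩ ⟨k⟩, h ⟨j⟩ ⟨l⟩, ← S.comb_half, ← S.comb_half]
      congr 1
      exact Weight.ext fun i => by simp only [Weight.half_apply]; ring
    exact e 0 1 2 3

theorem comb_mix_dirac (S : CombinationStructure.{v} K X) {I J : Type v} (w : Weight K I)
    (f : I → J) (x : J → X) :
    S.comb (w.mix fun i => Weight.dirac K (f i)) x = S.comb w fun i => x (f i) := by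
  simp only [← S.comb_comb, S.comb_dirac]

/-- `t • (a • x + b • z) + s • z = c • x + d • z` with `c = t * a`. -/
theorem binary_binary (S : CombinationStructure.{v} K X) {a b t s c d : ℝ} (ha : 0 ≤ a)
    (hb : 0 ≤ b) (hab : a + b = 1) (ht : 0 ≤ t) (hs : 0 ≤ s) (hts : t + s = 1) (hc : 0 ≤ c)
    (hd : 0 ≤ d) (hcd : c + d = 1) (h : c = t * a) (x z : X) :
    S.binary t s ht hs hts (S.binary a b ha hb hab x z) z = S.binary c d hc hd hcd x z := by
  have hz : z = S.comb (Weight.dirac K ⟨1⟩) fun i : ULift.{v} (Fin 2) => ![x, z] i.down :=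
    (S.comb_dirac (⟨1⟩ : ULift.{v} (Fin 2)) fun i => ![x, z] i.down).symm
  conv_lhs => arg 8; rw [hz]
  rw [binary.eq_def S a b, ← S.comb_convexComb, binary]
  congr 1
  refine Weight.ext fun ⟨i⟩ => ?_
  obtain rfl : s = 1 - t := by linarith
  obtain rfl : b = 1 - a := by linarith
  obtain rfl : d = 1 - c := by linarith
  subst h
  fin_cases i
  · simp [Weight.pair, Weight.dirac_apply]
  · simp [Weight.pair]
    ring

theorem binary_one (S : CombinationStructure.{v} K X) {a b : ℝ} (ha : 0 ≤ a) (hb : 0 ≤ b)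
    (hab : a + b = 1) (h : a = 1) (x z : X) : S.binary a b ha hb hab x z = x := by
  obtain rfl : b = 0 := by linarith
  subst h
  refine Eq.trans ?_ (S.comb_dirac (⟨0⟩ : ULift.{v} (Fin 2)) fun i => ![x, z] i.down)
  rw [binary]
  congr 1
  refine Weight.ext fun ⟨i⟩ => ?_
  fin_cases i <;> simp [Weight.pair, Weight.dirac_apply]

theorem iterate_mid (S : CombinationStructure.{v} K X) (z : X) (n : ℕ) {a b : ℝ} (ha : 0 ≤ a)
    (hb : 0 ≤ b) (hab : a + b = 1) (h : a = (1 / 2) ^ n) (x : X) :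
    (fun p => S.mid p z)^[n] x = S.binary a b ha hb hab x z := by
  induction n generalizing a b with
  | zero => exact (S.binary_one ha hb hab (by simpa using h) x z).symm
  | succ n ih =>
    have h1 : (1 / 2 : ℝ) ^ n ≤ 1 := pow_le_one₀ (by norm_num) (by norm_num)
    rw [Function.iterate_succ_apply', ih (a := (1 / 2) ^ n) (b := 1 - (1 / 2) ^ n) (by positivity)
      (by linarith) (by ring) rfl]
    exact S.binary_binary _ _ _ _ _ _ ha hb hab (by rw [h, pow_succ]; ring) x z

/-- Cancellation of midpoints gives cancellation of all proper binary combinations: scale the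
weight of the element to be isolated down to a power of `1 / 2`. -/
theorem isCancellative_of_mid (S : CombinationStructure.{v} K X)
    (h : IsCancellativeMidpoint S.mid) : S.IsCancellative := by
  intro a b ha hb hab x y z hxy
  obtain ⟨n, hn⟩ := exists_pow_lt_of_lt_one ha (by norm_num : (1 / 2 : ℝ) < 1)
  have h1 : (1 / 2 : ℝ) ^ n / a ≤ 1 := (div_le_one ha).2 hn.le
  have key : ∀ p : X, (fun p => S.mid p z)^[n] p = S.binary ((1 / 2) ^ n / a)
      (1 - (1 / 2) ^ n / a) (by positivity) (by linarith) (by ring)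
      (S.binary a b ha.le hb.le hab p z) z := fun p => by
    rw [S.iterate_mid z n (a := (1 / 2) ^ n) (b := 1 - (1 / 2) ^ n) (by positivity)
      (by linarith) (by ring) rfl]
    exact (S.binary_binary _ _ _ _ _ _ _ _ _ (by field_simp) p z).symm
  have hinj : Function.Injective fun p => S.mid p z := fun p q hpq => by
    refine h z p q ?_
    rw [S.isMidpoint_mid.comm z, S.isMidpoint_mid.comm z]
    exact hpq
  refine hinj.iterate n ?_
  rw [key, key, hxy]

theorem IsCancellative.mid {S : CombinationStructure.{v} K X} (h : S.IsCancellative) :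
    IsCancellativeMidpoint S.mid := by
  intro x y z hyz
  rw [S.isMidpoint_mid.comm x, S.isMidpoint_mid.comm x] at hyz
  exact h _ _ (by norm_num) (by norm_num) (by norm_num) y z x hyz

/-- The solution of `k y = m (h y) (k (t y))` is `k y = ∑ n, 2⁻⁽ⁿ⁺¹⁾ • h (t^[n] y)`. -/
theorem IsIterative.isIterativeMidpoint {S : SuperconvexStructure.{v} X} (hS : S.IsIterative) :
    IsIterativeMidpoint S.mid where
  toIsMidpoint := S.isMidpoint_mid
  iterative Y c := by
    let t : Y → Y := fun y => (c y).2
    refine ⟨fun y => S.comb Weight.geometric fun i => (c (t^[i.down] y)).1, fun y => ?_,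
      fun k hk => ?_⟩
    · beta_reduce
      conv_lhs => rw [Weight.geometric_eq_half, S.comb_half, S.comb_dirac, S.comb_mix_dirac]
      rfl
    · funext y
      refine hS (fun _ => 1 / 2) (fun _ => 1 / 2) (fun _ => by norm_num) (fun _ => by norm_num)
        (fun _ => by norm_num) Weight.tendsto_prod_half (fun n => k (t^[n] y))
        (fun n => (c (t^[n] y)).1) fun n => ?_
      refine (hk _).trans ?_
      rw [Function.iterate_succ_apply']
      rfl

end CombinationStructure

/-! ### Iterativity of the superconvex structure -/

theorem MidpointTerm.eval_congr {K : Kind} {I : Type v} {X : Type u} {m : X → X → X} {x y : I → X}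
    {t : MidpointTerm I} (h : ∀ i, t.weight K i ≠ 0 → x i = y i) : t.eval m x = t.eval m y := by
  induction t with
  | var i => exact h i (by simp [weight])
  | mid s t hs ht =>
    simp only [eval]
    rw [hs fun i hi => h i ?_, ht fun i hi => h i ?_]
    · have h1 := (s.weight K).nonneg i
      have h2 := ((t.weight K).nonneg i).lt_of_ne' hi
      rw [weight, Weight.half_apply]
      positivity
    · have h1 := ((s.weight K).nonneg i).lt_of_ne' hi
      have h2 := (t.weight K).nonneg i
      rw [weight, Weight.half_apply]
      positivity

namespace Weight

variable {K : Kind}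

/-- Two weight functions that agree at all indices but one are equal, as both have sum `1`. -/
theorem ext_of_ne {I : Type v} {w w' : Weight K I} (k : I) (h : ∀ i, i ≠ k → w i = w' i) :
    w = w' := by
  refine ext fun i => ?_
  by_cases hi : i = k
  · subst hi
    have h1 := w.hasSum.sub w'.hasSum
    have h2 := hasSum_single (f := fun j => w j - w' j) i
      fun j hj => sub_eq_zero.2 (h j hj)
    have h3 := h1.unique h2
    linarith
  · exact h i hi

/-- The total weight `1 - ∑ i < n, w i` of the indices `i ≥ n`. -/
def tail (w : Weight K (ULift.{v} ℕ)) (n : ℕ) : ℝ := 1 - ∑ i ∈ Finset.range n, w ⟨i⟩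

theorem hasSum_tail (w : Weight K (ULift.{v} ℕ)) (n : ℕ) :
    HasSum (fun i : ULift.{v} ℕ => if i.down < n then 0 else w i) (w.tail n) := by
  rw [← Equiv.ulift.symm.hasSum_iff]
  have h1 : HasSum (fun i : ℕ => w ⟨i⟩) 1 := Equiv.ulift.symm.hasSum_iff.2 w.hasSum
  have h2 : HasSum (fun i : ℕ => if i < n then w ⟨i⟩ else 0) (∑ i ∈ Finset.range n, w ⟨i⟩) := by
    have h := hasSum_sum_of_ne_finset_zero (f := fun i : ℕ => if i < n then w ⟨i⟩ else 0)
      (s := Finset.range n) (L := .unconditional ℕ) fun i hi => if_neg (by simpa using hi)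
    rwa [Finset.sum_congr rfl fun i hi => if_pos (Finset.mem_range.1 hi)] at h
  refine (h1.sub h2).congr_fun fun i => ?_
  by_cases hi : i < n <;> simp [hi]

theorem tail_iterated (a b : ℕ → ℝ) (ha : ∀ i, 0 ≤ a i) (hb : ∀ i, 0 ≤ b i)
    (hab : ∀ i, a i + b i = 1)
    (hlim : Tendsto (fun n => ∏ i ∈ Finset.range n, b i) atTop (𝓝 0)) (n : ℕ) :
    (iterated.{v} a b ha hb hab hlim).tail n = ∏ i ∈ Finset.range n, b i := by
  induction n with
  | zero => simp [tail]
  | succ n ih =>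
    rw [Finset.prod_range_succ, ← ih, tail, Finset.sum_range_succ, ← sub_sub]
    change _ - a n * ∏ i ∈ Finset.range n, b i = _
    rw [← ih, eq_sub_of_add_eq' (hab n)]
    simp only [tail]
    ring

/-- Beyond some index, `w` distributes the remaining weight in the proportions `a n` and
`1 - a n` to the index `n` and to the larger indices. -/
def IsEventuallyIterated (a : ℕ → ℝ) (w : Weight K (ULift.{v} ℕ)) : Prop :=
  ∀ᶠ n in atTop, w ⟨n⟩ = a n * w.tail n

theorem eventually_below_eq_zero (w : Weight K (ULift.{v} ℕ)) :
    ∀ᶠ n in atTop, ∀ i : ULift.{v} ℕ, n ≤ i.down → w.below.weight K i = 0 := by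
  obtain ⟨N, hN⟩ := (w.below.finite_support_weight.image ULift.down).bddAbove
  filter_upwards [eventually_gt_atTop N] with n hn i hi
  by_contra h
  exact absurd (hN (Set.mem_image_of_mem _ h)) (by omega)

theorem IsEventuallyIterated.rest {a : ℕ → ℝ} {w : Weight K (ULift.{v} ℕ)}
    (h : w.IsEventuallyIterated a) : w.rest.IsEventuallyIterated a := by
  filter_upwards [h, w.eventually_below_eq_zero] with n hn h0
  have h1 : (w.below.weight K).tail n = 0 := by
    refine ((w.below.weight K).hasSum_tail n).unique (hasSum_zero.congr_fun fun i => ?_)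
    split_ifs with hi
    · rfl
    · exact h0 i (by omega)
  have h2 : w.rest.tail n = 2 * w.tail n - (w.below.weight K).tail n := by
    simp only [tail, rest_apply, Finset.sum_sub_distrib, ← Finset.mul_sum]
    ring
  rw [rest_apply, h0 _ le_rfl, h2, h1, hn]
  ring

end Weight

namespace CombinationStructure

variable {X : Type u}

/-- The family `y 0, …, y (n - 1), x n, x n, …`. -/
def truncated (x y : ℕ → X) (n : ℕ) (i : ULift.{v} ℕ) : X := if i.down < n then y i.down else x n

/-- Replacing the entries `x n` at the indices `i ≥ n` by `y n` at `n` and `x (n + 1)` beyond does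
not change the combination, if the weight at `n` is the fraction `a n` of the total weight at these
indices. -/
theorem comb_truncated_succ (S : SuperconvexStructure.{v} X) {a b : ℕ → ℝ} (ha : ∀ i, 0 ≤ a i)
    (hb : ∀ i, 0 ≤ b i) (hab : ∀ i, a i + b i = 1) {x y : ℕ → X}
    (hx : ∀ i, x i = S.binary (a i) (b i) (ha i) (hb i) (hab i) (y i) (x (i + 1)))
    {w : Weight Kind.superconvex (ULift.{v} ℕ)} {n : ℕ} (hw : w ⟨n⟩ = a n * w.tail n) :
    S.comb w (truncated x y n) = S.comb w (truncated x y (n + 1)) := by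
  -- Both families are combinations of the second one, with the same resulting mixed weights.
  let μ : ULift.{v} ℕ → Weight Kind.superconvex (ULift.{v} ℕ) := fun i =>
    if i.down < n then Weight.dirac _ i else
      Weight.convexComb (a n) (b n) (ha n) (hb n) (hab n) (Weight.dirac _ ⟨n⟩)
        (Weight.dirac _ ⟨n + 1⟩)
  let ν : ULift.{v} ℕ → Weight Kind.superconvex (ULift.{v} ℕ) := fun i =>
    if i.down < n + 1 then Weight.dirac _ i else Weight.dirac _ ⟨n + 1⟩
  have hμ : truncated x y n = fun i => S.comb (μ i) (truncated x y (n + 1)) := by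
    funext i
    by_cases hi : i.down < n
    · simp only [μ, if_pos hi, S.comb_dirac, truncated]
      rw [if_pos (by omega)]
    · simp only [μ, if_neg hi, S.comb_convexComb, S.comb_dirac, truncated]
      rw [if_pos (by omega), if_neg (by omega)]
      exact hx n
  have hν : truncated x y (n + 1) = fun i => S.comb (ν i) (truncated x y (n + 1)) := by
    funext i
    by_cases hi : i.down < n + 1
    · simp only [ν, if_pos hi, S.comb_dirac]
    · simp only [ν, if_neg hi, S.comb_dirac, truncated]
      rw [if_neg (by omega)]
  have hmix : w.mix μ = w.mix ν := by
    refine Weight.ext_of_ne ⟨n + 1⟩ fun j hj => ?_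
    rw [Weight.mix_apply, Weight.mix_apply]
    by_cases hjn : j = ⟨n⟩
    · subst hjn
      have h1 : ∑' i, w i * ν i ⟨n⟩ = w ⟨n⟩ := by
        rw [tsum_eq_single ⟨n⟩ fun i hi => ?_]
        · simp [ν]
        · simp only [ν]
          split_ifs
          · rw [Weight.dirac_of_ne hi.symm, mul_zero]
          · rw [Weight.dirac_of_ne hj, mul_zero]
      rw [h1, hw, ← ((w.hasSum_tail n).mul_left (a n)).tsum_eq]
      refine tsum_congr fun i => ?_
      simp only [μ]
      split_ifs with hi
      · rw [Weight.dirac_of_ne, mul_zero, mul_zero]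
        rintro rfl
        exact absurd hi (lt_irrefl _)
      · rw [Weight.convexComb_apply, Weight.dirac_self, Weight.dirac_of_ne hj]
        ring
    · refine tsum_congr fun i => ?_
      congr 1
      simp only [μ, ν]
      split_ifs with h1 h2 h2
      · rfl
      · omega
      · obtain rfl : i = ⟨n⟩ := ULift.ext _ _ (by simp only; omega)
        rw [Weight.convexComb_apply, Weight.dirac_of_ne hj, Weight.dirac_of_ne hjn]
        ring
      · rw [Weight.convexComb_apply, Weight.dirac_of_ne hj, Weight.dirac_of_ne hjn]
        ring
  rw [hμ, S.comb_comb, hmix, ← S.comb_comb, ← hν]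

/-- The combinations of the families `truncated x y n` with a fixed eventually iterated weight
function stabilise as `n` grows, and the stable value satisfies the recursion that characterises
the combination of `y`. -/
theorem isIterative_of_mid (S : SuperconvexStructure.{v} X) (hm : IsIterativeMidpoint S.mid) :
    S.IsIterative := by
  intro a b ha hb hab hlim x y hx
  have hstab : ∀ w : Weight Kind.superconvex (ULift.{v} ℕ), w.IsEventuallyIterated a →
      ∃ p, ∀ᶠ n in atTop, S.comb w (truncated x y n) = p := fun w hw => by
    obtain ⟨N, hN⟩ := eventually_atTop.1 hw
    refine ⟨S.comb w (truncated x y N), eventually_atTop.2 ⟨N, fun n hn => ?_⟩⟩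
    induction n, hn using Nat.le_induction with
    | base => rfl
    | succ n hn ih =>
      rw [← ih]
      exact (S.comb_truncated_succ (fun i => (ha i).le) (fun i => (hb i).le) hab hx
        (hN n hn)).symm
  have : Nonempty X := ⟨x 0⟩
  let F : Weight Kind.superconvex (ULift.{v} ℕ) → X := fun w =>
    Classical.epsilon fun p => ∀ᶠ n in atTop, S.comb w (truncated x y n) = p
  have hF : ∀ w, w.IsEventuallyIterated a → ∀ᶠ n in atTop, S.comb w (truncated x y n) = F w :=
    fun w hw => Classical.epsilon_spec (hstab w hw)
  set W := Weight.iterated.{v} a b (fun i => (ha i).le) (fun i => (hb i).le) hab hlim with hW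
  have hWn : ∀ n, W ⟨n⟩ = a n * W.tail n := fun n => by rw [hW, Weight.tail_iterated]; rfl
  have key := hm.eq_comb_of_rec (fun i : ULift.{v} ℕ => y i.down)
    (Weight.IsEventuallyIterated a) (fun w hw => hw.rest) F (fun w hw => by
      obtain ⟨n, h1, h2, h3⟩ :=
        ((hF w hw).and ((hF w.rest hw.rest).and w.eventually_below_eq_zero)).exists
      rw [← h1, ← h2]
      nth_rewrite 1 [← w.half_below_rest]
      rw [S.comb_half, MidpointTerm.map_weight_eq_eval (m := S.mid)
        (fun w => S.comb w (truncated x y n)) fun w w' => S.comb_half w w' _]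
      simp only [S.comb_dirac]
      congr 1
      refine MidpointTerm.eval_congr (K := Kind.superconvex) fun i hi => ?_
      exact if_pos (by
        by_contra hc
        exact hi (h3 i (by omega)))) (w := W) (.of_forall hWn)
  rw [S.comb_eq hm rfl, ← key]
  obtain ⟨n, hn⟩ := (hF W (.of_forall hWn)).exists
  rw [← hn]
  clear hn
  induction n with
  | zero =>
    have h := hm.eq_comb_of_hom (K := Kind.superconvex) (I := ULift.{v} ℕ) (fun _ => x 0)
      (fun _ _ => (hm.idem _).symm) W
    rw [S.comb_eq hm rfl]
    exact h
  | succ n ih =>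
    rw [ih]
    exact S.comb_truncated_succ (fun i => (ha i).le) (fun i => (hb i).le) hab hx (hWn n)

end CombinationStructure

/-! ### The isomorphism of categories -/

/-- The functor equipping an iterative midpoint set with its superconvex structure. -/
noncomputable def toSuperconvex : IterMidpointSet.{u} ⥤ IterSuperconvexSet.{v, u} where
  obj A := ⟨A.carrier, A.isIterative.combinationStructure _,
    CombinationStructure.isIterative_of_mid _ (by
      rw [IsIterativeMidpoint.mid_combinationStructure]; exact A.isIterative)⟩
  map {A B} f := ⟨f.1, (CombinationStructure.isAffine_iff_isMidpointHom B.isIterative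
    (A.isIterative.mid_combinationStructure _) (B.isIterative.mid_combinationStructure _)).2 f.2⟩

theorem IterMidpointSet.eqToHom_val {X : Type u} {m m' : X → X → X} {h : IsIterativeMidpoint m}
    {h' : IsIterativeMidpoint m'} (e : (⟨X, m, h⟩ : IterMidpointSet) = ⟨X, m', h'⟩) :
    (eqToHom e).1 = id := by
  cases e
  rfl

theorem IterSuperconvexSet.eqToHom_val {X : Type u} {S S' : SuperconvexStructure.{v} X}
    {h : S.IsIterative} {h' : S'.IsIterative}
    (e : (⟨X, S, h⟩ : IterSuperconvexSet) = ⟨X, S', h'⟩) : (eqToHom e).1 = id := by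
  cases e
  rfl

theorem isCategoryIso_forgetToMidpoint
    (h : ∀ A : IterSuperconvexSet.{v, u}, IsIterativeMidpoint A.str.mid) :
    IsCategoryIso (forgetToMidpoint h) := by
  have h1 : ∀ A, (forgetToMidpoint h ⋙ toSuperconvex).obj A = A := fun ⟨X, S, hS⟩ => by
    have e : (h ⟨X, S, hS⟩).combinationStructure _ = S :=
      CombinationStructure.ext fun w x => (S.comb_eq (h ⟨X, S, hS⟩) rfl w x).symm
    simp only [forgetToMidpoint, toSuperconvex, Functor.comp_obj, e]
  have h2 : ∀ A, (toSuperconvex ⋙ forgetToMidpoint h).obj A = A := fun ⟨X, m, hm⟩ => by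
    simp only [forgetToMidpoint, toSuperconvex, Functor.comp_obj,
      IsIterativeMidpoint.mid_combinationStructure]
  refine ⟨toSuperconvex, CategoryTheory.Functor.ext h1 fun A B f => Subtype.ext ?_,
    CategoryTheory.Functor.ext h2 fun A B f => Subtype.ext ?_⟩
  · change f.1 = (eqToHom (h1 B).symm).1 ∘ f.1 ∘ (eqToHom (h1 A)).1
    erw [IterSuperconvexSet.eqToHom_val (h1 A), IterSuperconvexSet.eqToHom_val (h1 B).symm]
    rfl
  · change f.1 = (eqToHom (h2 B).symm).1 ∘ f.1 ∘ (eqToHom (h2 A)).1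
    erw [IterMidpointSet.eqToHom_val (h2 A), IterMidpointSet.eqToHom_val (h2 B).symm]
    rfl

theorem functor_eq_of_comp_ι_eq {C D : Type*} [Category* C] [Category* D] {P : ObjectProperty D}
    {F G : C ⥤ P.FullSubcategory} (h : F ⋙ P.ι = G ⋙ P.ι) : F = G := by
  refine CategoryTheory.Functor.ext
    (fun A => ObjectProperty.FullSubcategory.ext (CategoryTheory.Functor.congr_obj h A))
    fun A B f => P.ι.map_injective ?_
  rw [CategoryTheory.Functor.map_comp, CategoryTheory.Functor.map_comp, eqToHom_map, eqToHom_map]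
  exact CategoryTheory.Functor.congr_hom h f

/-- An isomorphism of categories restricts to an isomorphism between full subcategories that
correspond to each other. -/
theorem IsCategoryIso.lift {C D : Type*} [Category* C] [Category* D] {F : C ⥤ D}
    (hF : IsCategoryIso F) {P : ObjectProperty C} {Q : ObjectProperty D}
    (hPQ : ∀ A, Q (F.obj A) → P A) (h : ∀ A : P.FullSubcategory, Q ((P.ι ⋙ F).obj A)) :
    IsCategoryIso (Q.lift (P.ι ⋙ F) h) := by
  obtain ⟨G, hFG, hGF⟩ := hF
  refine ⟨P.lift (Q.ι ⋙ G) fun B => hPQ _ ?_, functor_eq_of_comp_ι_eq ?_,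
    functor_eq_of_comp_ι_eq ?_⟩
  · have e : F.obj (G.obj B.obj) = B.obj := CategoryTheory.Functor.congr_obj hGF B.obj
    change Q (F.obj (G.obj B.obj))
    rw [e]
    exact B.property
  · change P.ι ⋙ (F ⋙ G) = P.ι
    rw [hFG]
    rfl
  · change Q.ι ⋙ (G ⋙ F) = Q.ι
    rw [hGF]
    rfl

end Superconvexity

/-! ### The correspondence -/

open Superconvexity in
theorem mainTheorem4 :
    -- from iterative superconvex sets to iterative midpoint sets
    (∀ (X : Type u) (S : SuperconvexStructure.{v} X), S.IsIterative →
      IsIterativeMidpoint S.mid ∧ (S.IsCancellative → IsCancellativeMidpoint S.mid)) ∧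
    -- from iterative midpoint sets to iterative superconvex sets
    (∀ (X : Type u) (m : X → X → X), IsIterativeMidpoint m →
      (∃! S : SuperconvexStructure.{v} X, S.mid = m) ∧
      ∀ S : SuperconvexStructure.{v} X, S.mid = m →
        S.IsIterative ∧ (IsCancellativeMidpoint m → S.IsCancellative)) ∧
    -- midpoint homomorphisms, affine maps and superaffine maps coincide
    (∀ (X : Type u) (m : X → X → X), IsIterativeMidpoint m →
      ∃! C : ConvexStructure.{v} X, C.mid = m) ∧
    (∀ (X X' : Type u) (m : X → X → X) (m' : X' → X' → X'),
      IsIterativeMidpoint m → IsIterativeMidpoint m' →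
      ∀ (S : SuperconvexStructure.{v} X) (S' : SuperconvexStructure.{v} X')
        (C : ConvexStructure.{v} X) (C' : ConvexStructure.{v} X'),
        S.mid = m → S'.mid = m' → C.mid = m → C'.mid = m' →
        ∀ f : X → X', List.TFAE [IsMidpointHom m m' f, C.IsAffine C' f, S.IsAffine S' f]) ∧
    -- the forgetful functor is an isomorphism of categories, also on the cancellative objects
    (∃ h : ∀ A : IterSuperconvexSet.{v, u}, IsIterativeMidpoint A.str.mid,
      IsCategoryIso (forgetToMidpoint h) ∧
      ∃ hc : ∀ A : cancSuperconvex.{v, u}.FullSubcategory,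
          cancMidpoint ((cancSuperconvex.{v, u}.ι ⋙ forgetToMidpoint h).obj A),
        IsCategoryIso
          (cancMidpoint.lift (cancSuperconvex.{v, u}.ι ⋙ forgetToMidpoint h) hc)) := by
  refine ⟨fun X S hS => ⟨hS.isIterativeMidpoint, fun h => h.mid⟩, fun X m hm =>
    ⟨hm.existsUnique_combinationStructure _, ?_⟩,
    fun X m hm => hm.existsUnique_combinationStructure _, ?_,
    fun A => A.isIterative.isIterativeMidpoint, isCategoryIso_forgetToMidpoint _,
    fun A => CombinationStructure.IsCancellative.mid A.property,
    (isCategoryIso_forgetToMidpoint _).lift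
      (fun A h => CombinationStructure.isCancellative_of_mid A.str h) _⟩
  · rintro S rfl
    exact ⟨S.isIterative_of_mid hm, S.isCancellative_of_mid⟩
  · intro X X' m m' _ hm' S S' C C' hS hS' hC hC' f
    tfae_have 1 ↔ 2 :=
      (CombinationStructure.isAffine_iff_isMidpointHom hm' hC hC').symm
    tfae_have 1 ↔ 3 :=
      (CombinationStructure.isAffine_iff_isMidpointHom hm' hS hS').symm
    tfae_finish
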